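/- **Theorem (Bound from below).** There is a universal constant $c>0$ with the following property. Let $n,K\ge 1$ be integers and let $\tau,\sigma,\bar\delta>0$. Consider any (possibly randomized and adaptive) algorithm of fixed length $K$ on $\mathbb{R}^n$: at step $k=1,\dots,K$ it chooses, as a measurable function of its internal random seed and of the previous oracle answers $v_1,\dots,v_{k-1}$, a point $x_k\in\mathbb{R}^n$, a smoothing parameter $\delta_k\in(0,\bar\delta]$ and a direction $u_k\in\mathbb{S}^{n-1}$ (for instance $u_k$ uniform on $\mathbb{S}^{n-1}$), and it receives the answer $$v_k=\Im\big(f(x_k+i\delta_k u_k)\big)+\xi_k ,$$ where $f$ also denotes the holomorphic extension of the objective function to $\mathbb{C}^n$ and $\xi_1,\dots,\xi_K$ are i.i.d. $N(0,\sigma)$ random variables (variance $\sigma$), independent of the seed. Finally it returns a point $x'_K\in\mathbb{R}^n$, a measurable function of the seed and of $v_1,\dots,v_K$. Then for every such algorithm there is a $\tau$-strongly convex quadratic function $f:\mathbb{R}^n\to\mathbb{R}$, with minimizer $x^\star$, such that $$\mathbb{E}\big[f(x'_K)-f(x^\star)\big]\;\ge\; c\,\frac{n^2\sigma}{\tau\,\bar\delta^{2}K}.$$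 In particular, if all smoothing parameters lie in $(0,1)$, then the worst-case expected optimization error over all $\tau$-strongly convex quadratic functions is at least $c\,n^2\sigma/(\tau K)=\Omega\big(n^2/(\tau K)\big)$. -/

import Mathlib

open MeasureTheory ProbabilityTheory
open scoped NNReal ENNReal Matrix

noncomputable section

namespace ImZO

/-- Quadratic functions on `ℝⁿ`: `f x = ½ xᵀ P x + qᵀ x + r` with `P` symmetric. -/
def IsQuadratic {n : ℕ} (f : EuclideanSpace ℝ (Fin n) → ℝ) : Prop :=
  ∃ (P : Matrix (Fin n) (Fin n) ℝ) (q : Fin n → ℝ) (r : ℝ), P.IsSymm ∧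
    ∀ x, f x = (1 / 2 : ℝ) * (x.ofLp ⬝ᵥ (P *ᵥ x.ofLp)) + q ⬝ᵥ x.ofLp + r

/-- `F` is a holomorphic function on `ℂⁿ` which restricts to `f` on `ℝⁿ`. -/
def IsHolomorphicExtension {n : ℕ} (F : (Fin n → ℂ) → ℂ)
    (f : EuclideanSpace ℝ (Fin n) → ℝ) : Prop :=
  Differentiable ℂ F ∧ ∀ x : EuclideanSpace ℝ (Fin n), F (fun j => (x j : ℂ)) = (f x : ℂ)

/-- The point `x + i δ u` of `ℂⁿ`. -/
def complexPoint {n : ℕ} (x : EuclideanSpace ℝ (Fin n)) (δ : ℝ)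
    (u : EuclideanSpace ℝ (Fin n)) : Fin n → ℂ :=
  fun j => (x j : ℂ) + Complex.I * (δ : ℂ) * (u j : ℂ)

/-- A randomized algorithm of length `K` on `ℝⁿ`, with internal randomness (a seed) in `S`.
At step `k` it chooses a test point, a smoothing parameter and a direction on the unit sphere,
each depending on the seed and on the oracle answers of the previous steps. After `K` answers it
returns a point. Random directions, such as uniform ones, are part of the seed. -/
structure Algorithm (n K : ℕ) (S : Type*) [MeasurableSpace S] where
  point : (k : Fin K) → S → (Fin k → ℝ) → EuclideanSpace ℝ (Fin n)
  radius : (k : Fin K) → S → (Fin k → ℝ) → ℝ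
  direction : (k : Fin K) → S → (Fin k → ℝ) → EuclideanSpace ℝ (Fin n)
  output : S → (Fin K → ℝ) → EuclideanSpace ℝ (Fin n)
  radius_pos : ∀ k s v, 0 < radius k s v
  norm_direction : ∀ k s v, ‖direction k s v‖ = 1
  measurable_point : ∀ k : Fin K, Measurable (fun p : S × (Fin k → ℝ) => point k p.1 p.2)
  measurable_radius : ∀ k : Fin K, Measurable (fun p : S × (Fin k → ℝ) => radius k p.1 p.2)
  measurable_direction : ∀ k : Fin K, Measurable (fun p : S × (Fin k → ℝ) => direction k p.1 p.2)
  measurable_output : Measurable (fun p : S × (Fin K → ℝ) => output p.1 p.2)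

namespace Algorithm

variable {n K : ℕ} {S : Type*} [MeasurableSpace S]

/-- The noiseless answer `Im F(x + i δ u)` to the query of step `k`, made after the answers `v`. -/
def response (A : Algorithm n K S) (F : (Fin n → ℂ) → ℂ) (s : S) (k : Fin K)
    (v : Fin k → ℝ) : ℝ :=
  (F (complexPoint (A.point k s v) (A.radius k s v) (A.direction k s v))).im

/-- The first `k` noisy answers: the answer of step `j` is `Im F(x_j + i δ_j u_j) + ξ j`. -/
def answers (A : Algorithm n K S) (F : (Fin n → ℂ) → ℂ) (s : S) (ξ : Fin K → ℝ) :
    (k : ℕ) → k ≤ K → (Fin k → ℝ)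
  | 0, _ => Fin.elim0
  | k + 1, h =>
      Fin.snoc (α := fun _ => ℝ) (A.answers F s ξ k (Nat.le_of_succ_le h))
        (A.response F s ⟨k, h⟩ (A.answers F s ξ k (Nat.le_of_succ_le h)) + ξ ⟨k, h⟩)

/-- The point returned by the algorithm, as a function of its seed and of the oracle noise. -/
def result (A : Algorithm n K S) (F : (Fin n → ℂ) → ℂ) (s : S) (ξ : Fin K → ℝ) :
    EuclideanSpace ℝ (Fin n) :=
  A.output s (A.answers F s ξ K le_rfl)

/-- The expectation of `f x' - f xstar`, where `x'` is the point returned by the algorithm, the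
seed has law `μ`, and the noise of the `K` answers is i.i.d. centered Gaussian with variance `σ`
and independent of the seed. The expectation is `[0, ∞]`-valued, and meant for a minimizer
`xstar` of `f`, for which the integrand is nonnegative. -/
def expectedError (A : Algorithm n K S) (μ : Measure S) (σ : ℝ≥0)
    (f : EuclideanSpace ℝ (Fin n) → ℝ) (F : (Fin n → ℂ) → ℂ)
    (xstar : EuclideanSpace ℝ (Fin n)) : ℝ≥0∞ :=
  ∫⁻ p : S × (Fin K → ℝ), ENNReal.ofReal (f (A.result F p.1 p.2) - f xstar)
    ∂(μ.prod (Measure.pi fun _ : Fin K => gaussianReal 0 σ))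

end Algorithm

end ImZO

end

namespace ImZO

/-! The hard functions are `τ / 2 * ‖x - θ‖²` with a Gaussian prior `N(0, ρ I)` on `θ`. Every answer
is then affine in `θ` plus Gaussian noise, so the algorithm does linear regression with design rows
`τ δ_k u_k`. Adaptivity is removed by a change of measure (`lintegral_answers`): relative to pure
noise, the answers have a product of likelihood ratios as density. After exchanging integrals, seed
and answers are fixed data, hence so are the queries, and the likelihood is log-quadratic in `θ`.
Given the other coordinates, `θ_j` has a Gaussian posterior of precision `α_j + ρ⁻¹`, and no output
beats its variance. As `‖u_k‖ = 1`, the sum of the `α_j` is at most `K τ² δmax² / σ`: the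
information is shared among `n` coordinates, and Cauchy–Schwarz yields the factor `n²`. Some `θ` is
as bad as the average. -/

/-! ### Gaussian integrals and reweighting -/

/-- In an integral over a product of probability measures, one coordinate may be resampled. -/
theorem lintegral_pi_eq_lintegral_update {ι : Type*} [Fintype ι] [DecidableEq ι]
    {X : ι → Type*} [∀ i, MeasurableSpace (X i)] (μ : ∀ i, Measure (X i))
    [∀ i, IsProbabilityMeasure (μ i)] {f : (∀ i, X i) → ℝ≥0∞} (hf : Measurable f) (i : ι) :
    ∫⁻ x, f x ∂Measure.pi μ = ∫⁻ x, ∫⁻ t, f (Function.update x i t) ∂μ i ∂Measure.pi μ := by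
  have hg : Measurable fun x => ∫⁻ t, f (Function.update x i t) ∂μ i := by
    have := hf.lmarginal μ (s := {i})
    rwa [lmarginal_singleton] at this
  refine lintegral_eq_of_lmarginal_eq {i} hf hg ?_
  ext x
  simp [lmarginal_singleton]

/-- Unnormalized Bayes' rule at the level of densities; it serves both for translating the noise and
for computing posteriors. -/
theorem lintegral_gaussianReal_mul_of_gaussianPDFReal_mul {m m' : ℝ} {v v' : ℝ≥0} (hv : v ≠ 0)
    (hv' : v' ≠ 0) {g : ℝ → ℝ} (hg : Measurable g) {c : ℝ} (hc : 0 ≤ c)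
    (h : ∀ t, gaussianPDFReal m' v' t * g t = c * gaussianPDFReal m v t)
    {H : ℝ → ℝ≥0∞} (hH : Measurable H) :
    ∫⁻ t, H t * ENNReal.ofReal (g t) ∂gaussianReal m' v' =
      ENNReal.ofReal c * ∫⁻ t, H t ∂gaussianReal m v := by
  rw [gaussianReal_of_var_ne_zero _ hv, gaussianReal_of_var_ne_zero _ hv',
    lintegral_withDensity_eq_lintegral_mul _ (measurable_gaussianPDF _ _) (by fun_prop),
    lintegral_withDensity_eq_lintegral_mul _ (measurable_gaussianPDF _ _) hH,
    ← lintegral_const_mul _ ((measurable_gaussianPDF _ _).mul hH)]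
  refine lintegral_congr fun t => ?_
  simp only [Pi.mul_apply, gaussianPDF]
  rw [mul_left_comm, ← ENNReal.ofReal_mul (gaussianPDFReal_nonneg _ _ _), h,
    ENNReal.ofReal_mul hc]
  ring

/-- Translating a centered Gaussian variable amounts to inserting a likelihood ratio. -/
theorem lintegral_gaussianReal_add {σ : ℝ≥0} (hσ : σ ≠ 0) (m : ℝ) {H : ℝ → ℝ≥0∞}
    (hH : Measurable H) :
    ∫⁻ t, H (m + t) ∂gaussianReal 0 σ =
      ∫⁻ t, H t * ENNReal.ofReal (Real.exp ((m * t - m ^ 2 / 2) / σ)) ∂gaussianReal 0 σ := by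
  have hσ' : (σ : ℝ) ≠ 0 := by exact_mod_cast hσ
  rw [lintegral_gaussianReal_mul_of_gaussianPDFReal_mul (m := m) hσ hσ (by fun_prop) zero_le_one
    (fun t => ?_) hH, ← lintegral_map hH (by fun_prop), gaussianReal_map_const_add]
  · simp
  · rw [gaussianPDFReal, gaussianPDFReal, mul_assoc, ← Real.exp_add, one_mul]
    congr 2
    field_simp
    ring

theorem le_lintegral_sub_sq_gaussianReal (a m : ℝ) (v : ℝ≥0) :
    ENNReal.ofReal v ≤ ∫⁻ t, ENNReal.ofReal ((a - t) ^ 2) ∂gaussianReal m v := by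
  have hL : MemLp (fun t : ℝ => a - t) 2 (gaussianReal m v) :=
    (memLp_const a).sub (memLp_id_gaussianReal' 2 (by simp))
  rw [← ofReal_integral_eq_lintegral_ofReal hL.integrable_sq
    (Filter.Eventually.of_forall fun t => sq_nonneg _)]
  refine ENNReal.ofReal_le_ofReal ?_
  have := variance_le_expectation_sq (μ := gaussianReal m v) (X := fun t : ℝ => a - t)
    (by fun_prop)
  rwa [variance_const_sub (by fun_prop), variance_fun_id_gaussianReal] at this

/-- The second moment about any point of a Gaussian prior reweighted by a log-quadratic
likelihood is at least the inverse of the posterior precision. -/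
theorem le_lintegral_sub_sq_mul_exp_quadratic {ρ : ℝ≥0} (hρ : ρ ≠ 0) {α : ℝ} (hα : 0 ≤ α)
    (a b c : ℝ) :
    ENNReal.ofReal (α + (ρ : ℝ)⁻¹)⁻¹ *
        ∫⁻ t, ENNReal.ofReal (Real.exp (-α / 2 * t ^ 2 + b * t + c)) ∂gaussianReal 0 ρ ≤
      ∫⁻ t, ENNReal.ofReal ((a - t) ^ 2) *
        ENNReal.ofReal (Real.exp (-α / 2 * t ^ 2 + b * t + c)) ∂gaussianReal 0 ρ := by
  have hρ' : (0 : ℝ) < ρ := by exact_mod_cast pos_iff_ne_zero.mpr hρ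
  have hΛ : 0 < α + (ρ : ℝ)⁻¹ := by positivity
  obtain ⟨v, hv⟩ : ∃ v : ℝ≥0, (v : ℝ) = (α + (ρ : ℝ)⁻¹)⁻¹ := ⟨⟨_, (inv_pos.mpr hΛ).le⟩, rfl⟩
  have hv0 : (0 : ℝ) < v := hv ▸ inv_pos.mpr hΛ
  have hvn : v ≠ 0 := by exact_mod_cast hv0.ne'
  have hα' : α = (v : ℝ)⁻¹ - (ρ : ℝ)⁻¹ := by rw [hv]; simp
  -- Completing the square gives posterior mean `v * b` and variance `v`; `C` collects what does not
  -- depend on `t`.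
  set C : ℝ := (√(2 * Real.pi * ρ))⁻¹ * √(2 * Real.pi * v) * Real.exp (c + v * b ^ 2 / 2) with hC
  have hpdf : ∀ t, gaussianPDFReal 0 ρ t * Real.exp (-α / 2 * t ^ 2 + b * t + c) =
      C * gaussianPDFReal (v * b) v t := by
    intro t
    have hs : √(2 * Real.pi * v) ≠ 0 := by positivity
    rw [gaussianPDFReal, gaussianPDFReal, hC, mul_assoc, ← Real.exp_add]
    have : -(t - 0) ^ 2 / (2 * (ρ : ℝ)) + (-α / 2 * t ^ 2 + b * t + c) =
        (c + v * b ^ 2 / 2) + -(t - v * b) ^ 2 / (2 * v) := by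
      rw [hα']
      field_simp
      ring
    rw [this, Real.exp_add]
    field_simp
  have hC0 : 0 ≤ C := by positivity
  rw [lintegral_gaussianReal_mul_of_gaussianPDFReal_mul hvn hρ (by fun_prop) hC0 hpdf
    (H := fun t => ENNReal.ofReal ((a - t) ^ 2)) (by fun_prop)]
  -- With `H = 1` this identifies `C` as the total mass.
  have h1 := lintegral_gaussianReal_mul_of_gaussianPDFReal_mul hvn hρ (by fun_prop) hC0 hpdf
    (H := fun _ => 1) (by fun_prop)
  simp only [one_mul, lintegral_one, measure_univ, mul_one] at h1
  rw [h1, mul_comm, ← hv]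
  gcongr
  exact le_lintegral_sub_sq_gaussianReal _ _ _

/-! ### The law of adaptive answers -/

namespace Algorithm

variable {n K : ℕ} {S : Type*} [MeasurableSpace S]

/-- The first `k` entries of a sequence of `K` answers. -/
def firstAnswers (k : ℕ) (h : k ≤ K) (w : Fin K → ℝ) : Fin k → ℝ := fun j => w (Fin.castLE h j)

theorem measurable_firstAnswers (k : ℕ) (h : k ≤ K) :
    Measurable (firstAnswers k h : (Fin K → ℝ) → Fin k → ℝ) := by
  unfold firstAnswers
  fun_prop

theorem firstAnswers_update (k : ℕ) (h : k ≤ K) (w : Fin K → ℝ) (i : Fin K) (hi : k ≤ i) (t : ℝ) :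
    firstAnswers k h (Function.update w i t) = firstAnswers k h w := by
  ext j
  refine Function.update_of_ne (fun hj => ?_) _ _
  have := congrArg Fin.val hj
  simp at this
  omega

theorem snoc_firstAnswers (k : ℕ) (h : k + 1 ≤ K) (w : Fin K → ℝ) :
    Fin.snoc (α := fun _ => ℝ) (firstAnswers k (Nat.le_of_succ_le h) w) (w ⟨k, h⟩) =
      firstAnswers (k + 1) h w := by
  ext j
  refine Fin.lastCases ?_ (fun j => ?_) j
  · rw [Fin.snoc_last]; rfl
  · simp [firstAnswers]

/-- Causality: the first `k` answers use only the noise of steps before `k`, so noise of index at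
least `k` can be resampled freely. -/
theorem answers_update (A : Algorithm n K S) (F : (Fin n → ℂ) → ℂ) (s : S) (ξ : Fin K → ℝ)
    (i : Fin K) (t : ℝ) : ∀ (k : ℕ) (h : k ≤ K), k ≤ i →
      A.answers F s (Function.update ξ i t) k h = A.answers F s ξ k h
  | 0, _, _ => rfl
  | k + 1, h, hi => by
    have hne : (⟨k, h⟩ : Fin K) ≠ i := fun e => by
      have := congrArg Fin.val e
      simp at this
      omega
    simp only [answers, answers_update A F s ξ i t k _ (Nat.le_of_succ_le hi),
      Function.update_of_ne hne]

theorem measurable_snoc (k : ℕ) :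
    Measurable fun p : (Fin k → ℝ) × ℝ =>
      (Fin.snoc (α := fun _ => ℝ) p.1 p.2 : Fin (k + 1) → ℝ) := by
  refine measurable_pi_lambda _ fun j => ?_
  refine Fin.lastCases ?_ (fun j => ?_) j
  · simpa using measurable_snd
  · simp only [Fin.snoc_castSucc]
    fun_prop

theorem measurable_answers (A : Algorithm n K S) {F : (Fin n → ℂ) → ℂ}
    (hm : ∀ k : Fin K, Measurable fun p : S × (Fin k → ℝ) => A.response F p.1 k p.2) :
    ∀ (k : ℕ) (h : k ≤ K), Measurable fun p : S × (Fin K → ℝ) => A.answers F p.1 p.2 k h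
  | 0, _ => measurable_const
  | k + 1, h => by
    have ih := measurable_answers A hm k (Nat.le_of_succ_le h)
    exact (measurable_snoc k).comp (ih.prodMk (((hm ⟨k, h⟩).comp (measurable_fst.prodMk ih)).add
      ((measurable_pi_apply _).comp measurable_snd)))

/-- The likelihood ratio of the `i`-th answer with respect to pure noise. -/
noncomputable def likelihood (A : Algorithm n K S) (F : (Fin n → ℂ) → ℂ) (σ : ℝ≥0)
    (s : S) (w : Fin K → ℝ) (i : Fin K) : ℝ :=
  Real.exp ((A.response F s i (firstAnswers i i.is_lt.le w) * w i -
    A.response F s i (firstAnswers i i.is_lt.le w) ^ 2 / 2) / σ)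

theorem measurable_likelihood (A : Algorithm n K S) {F : (Fin n → ℂ) → ℂ} {s : S} (σ : ℝ≥0)
    (hm : ∀ k, Measurable (A.response F s k)) (i : Fin K) :
    Measurable fun w => A.likelihood F σ s w i := by
  have := (hm i).comp (measurable_firstAnswers i i.is_lt.le)
  unfold likelihood
  simp only [Function.comp_def] at this
  fun_prop

theorem likelihood_update (A : Algorithm n K S) (F : (Fin n → ℂ) → ℂ) (σ : ℝ≥0) (s : S)
    (w : Fin K → ℝ) (i k : Fin K) (h : i < k) (t : ℝ) :
    A.likelihood F σ s (Function.update w k t) i = A.likelihood F σ s w i := by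
  rw [likelihood, likelihood, firstAnswers_update _ _ _ _ h.le, Function.update_of_ne h.ne]

/-- The law of the answers has a density with respect to the law of the noise, which is the product
of the likelihood ratios of the answers. -/
theorem lintegral_answers (A : Algorithm n K S) {F : (Fin n → ℂ) → ℂ} {s : S} {σ : ℝ≥0}
    (hσ : σ ≠ 0)
    (hm : ∀ k : Fin K, Measurable fun p : S × (Fin k → ℝ) => A.response F p.1 k p.2) :
    ∀ (k : ℕ) (h : k ≤ K) {G : (Fin k → ℝ) → ℝ≥0∞}, Measurable G →
      ∫⁻ ξ, G (A.answers F s ξ k h) ∂Measure.pi (fun _ : Fin K => gaussianReal 0 σ) =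
        ∫⁻ w, G (firstAnswers k h w) * ∏ i : Fin K with i.val < k,
          ENNReal.ofReal (A.likelihood F σ s w i) ∂Measure.pi (fun _ : Fin K => gaussianReal 0 σ)
  | 0, h, G, hG => by
    simp only [not_lt_zero, Finset.filter_false, Finset.prod_empty, mul_one]
    exact lintegral_congr fun ξ => congrArg G (Subsingleton.elim _ _)
  | k + 1, h, G, hG => by
    have hk := Nat.le_of_succ_le h
    have hs : ∀ k : Fin K, Measurable (A.response F s k) := fun k =>
      (hm k).comp measurable_prodMk_left
    have hsnoc : Measurable fun p : (Fin k → ℝ) × ℝ => G (Fin.snoc (α := fun _ => ℝ) p.1 p.2) :=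
      hG.comp (measurable_snoc k)
    have hlik : Measurable fun p : (Fin k → ℝ) × ℝ => ENNReal.ofReal (Real.exp
        ((A.response F s ⟨k, h⟩ p.1 * p.2 - A.response F s ⟨k, h⟩ p.1 ^ 2 / 2) / σ)) := by
      have : Measurable fun p : (Fin k → ℝ) × ℝ => A.response F s ⟨k, h⟩ p.1 :=
        (hs ⟨k, h⟩).comp measurable_fst
      fun_prop
    have hset : (Finset.univ.filter fun i : Fin K => i.val < k + 1) =
        insert ⟨k, h⟩ (Finset.univ.filter fun i : Fin K => i.val < k) := by
      ext i
      simp [Fin.ext_iff]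
      omega
    have hset' : (⟨k, h⟩ : Fin K) ∉ Finset.univ.filter fun i : Fin K => i.val < k := by simp
    rw [lintegral_pi_eq_lintegral_update _ (f := fun ξ => G (A.answers F s ξ (k + 1) h))
      (hG.comp ((A.measurable_answers hm _ h).comp measurable_prodMk_left)) ⟨k, h⟩]
    -- The last answer is integrated out, leaving a function of the first `k` answers for the
    -- induction hypothesis.
    set G' : (Fin k → ℝ) → ℝ≥0∞ := fun v => ∫⁻ t, G (Fin.snoc (α := fun _ => ℝ) v t) *
      ENNReal.ofReal (Real.exp ((A.response F s ⟨k, h⟩ v * t -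
        A.response F s ⟨k, h⟩ v ^ 2 / 2) / σ)) ∂gaussianReal 0 σ with hG'
    have hG'm : Measurable G' := (hsnoc.mul hlik).lintegral_prod_right'
    have step : ∀ ξ : Fin K → ℝ, ∫⁻ t, G (A.answers F s
        (Function.update ξ ⟨k, h⟩ t) (k + 1) h) ∂gaussianReal 0 σ = G' (A.answers F s ξ k hk) := by
      intro ξ
      rw [hG']
      beta_reduce
      rw [← lintegral_gaussianReal_add hσ _
        (H := fun t => G (Fin.snoc (α := fun _ => ℝ) (A.answers F s ξ k hk) t))
        (hsnoc.comp measurable_prodMk_left)]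
      refine lintegral_congr fun t => ?_
      simp only [answers, A.answers_update F s ξ ⟨k, h⟩ t k hk le_rfl,
        Function.update_self]
    simp_rw [step]
    rw [lintegral_answers A hσ hm k hk hG'm,
      lintegral_pi_eq_lintegral_update _ (f := fun w => G (firstAnswers (k + 1) h w) * _)
      ((hG.comp (measurable_firstAnswers _ h)).mul (Finset.measurable_prod _ fun i _ =>
        (A.measurable_likelihood σ hs i).ennreal_ofReal)) ⟨k, h⟩]
    refine lintegral_congr fun w => ?_
    refine (lintegral_mul_const _ ((hsnoc.mul hlik).comp measurable_prodMk_left)).symm.trans ?_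
    refine lintegral_congr fun t => ?_
    have hw : firstAnswers k hk (Function.update w ⟨k, h⟩ t) = firstAnswers k hk w :=
      firstAnswers_update k hk w ⟨k, h⟩ le_rfl t
    have hl : A.likelihood F σ s (Function.update w ⟨k, h⟩ t) ⟨k, h⟩ = Real.exp
        ((A.response F s ⟨k, h⟩ (firstAnswers k hk w) * t -
          A.response F s ⟨k, h⟩ (firstAnswers k hk w) ^ 2 / 2) / σ) := by
      rw [← hw, likelihood, Function.update_self]
    have hp : ∏ i : Fin K with i.val < k, ENNReal.ofReal
        (A.likelihood F σ s (Function.update w ⟨k, h⟩ t) i) =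
        ∏ i : Fin K with i.val < k, ENNReal.ofReal (A.likelihood F σ s w i) :=
      Finset.prod_congr rfl fun i hi => by
        rw [A.likelihood_update _ _ _ _ _ _ (by simpa [Fin.lt_def] using hi)]
    rw [hset, Finset.prod_insert hset', ← snoc_firstAnswers, hw, Function.update_self, hl, hp,
      ← mul_assoc]
    rfl

end Algorithm

/-! ### Bayes risk of linear regression -/

/-- Bayes risk of linear regression with a Gaussian prior on the parameter `θ`, given the
observation `w` of `D - Bθ` in Gaussian noise. -/
theorem le_lintegral_sum_sub_sq_mul_likelihood {n K : ℕ} (hn : 0 < n) {ρ σ : ℝ≥0} (hρ : ρ ≠ 0)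
    (B : Fin K → Fin n → ℝ) (D w : Fin K → ℝ) (a : Fin n → ℝ) {M : ℝ}
    (hM : ∑ k, ∑ j, B k j ^ 2 ≤ M) :
    ENNReal.ofReal ((n : ℝ) ^ 2 / (n / ρ + M / σ)) *
        ∫⁻ θ, ∏ k, ENNReal.ofReal (Real.exp (((D k - ∑ j, B k j * θ j) * w k -
          (D k - ∑ j, B k j * θ j) ^ 2 / 2) / σ)) ∂Measure.pi (fun _ : Fin n => gaussianReal 0 ρ) ≤
      ∫⁻ θ, ENNReal.ofReal (∑ j, (a j - θ j) ^ 2) *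
        ∏ k, ENNReal.ofReal (Real.exp (((D k - ∑ j, B k j * θ j) * w k -
          (D k - ∑ j, B k j * θ j) ^ 2 / 2) / σ))
        ∂Measure.pi (fun _ : Fin n => gaussianReal 0 ρ) := by
  set L : (Fin n → ℝ) → ℝ≥0∞ := fun θ => ∏ k, ENNReal.ofReal (Real.exp
    (((D k - ∑ j, B k j * θ j) * w k - (D k - ∑ j, B k j * θ j) ^ 2 / 2) / σ)) with hL
  have hLm : Measurable L := by fun_prop
  set α : Fin n → ℝ := fun j => (∑ k, B k j ^ 2) / σ with hα
  have hα0 : ∀ j, 0 ≤ α j := fun j => by positivity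
  have hρ' : (0 : ℝ) < ρ := by exact_mod_cast pos_iff_ne_zero.mpr hρ
  have hn' : (0 : ℝ) < n := by exact_mod_cast hn
  have hΛ : ∀ j, 0 < α j + (ρ : ℝ)⁻¹ := fun j => by have := hα0 j; positivity
  have hupd : ∀ θ j, ∃ b c : ℝ, ∀ t, L (Function.update θ j t) =
      ENNReal.ofReal (Real.exp (-α j / 2 * t ^ 2 + b * t + c)) := by
    intro θ j
    -- The residual with the `j`-th coordinate of `θ` set to zero.
    let E : Fin K → ℝ := fun k => D k - ∑ i, B k i * Function.update θ j 0 i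
    have hE : ∀ t k, D k - ∑ i, B k i * Function.update θ j t i = E k - B k j * t := by
      intro t k
      have : ∀ r : ℝ, ∑ i, B k i * Function.update θ j r i =
          B k j * r + ∑ i ∈ Finset.univ.erase j, B k i * θ i := by
        intro r
        rw [← Finset.add_sum_erase _ _ (Finset.mem_univ j), Function.update_self]
        congr 1
        refine Finset.sum_congr rfl fun i hi => ?_
        rw [Function.update_of_ne (Finset.ne_of_mem_erase hi)]
      simp only [E, this]
      ring
    refine ⟨(∑ k, (E k * B k j - B k j * w k)) / σ, (∑ k, (E k * w k - E k ^ 2 / 2)) / σ,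
      fun t => ?_⟩
    simp only [hL, hE]
    rw [← ENNReal.ofReal_prod_of_nonneg fun _ _ => (Real.exp_pos _).le, ← Real.exp_sum]
    congr 2
    rw [hα, ← Finset.sum_div]
    have : ∀ x y z : ℝ, -(x / σ) / 2 * t ^ 2 + y / σ * t + z / σ =
        (x * (-t ^ 2 / 2) + y * t + z) / σ := fun x y z => by ring
    rw [this, Finset.sum_mul, Finset.sum_mul, ← Finset.sum_add_distrib, ← Finset.sum_add_distrib]
    congr 1
    exact Finset.sum_congr rfl fun k _ => by ring
  have hcoord : ∀ j, ENNReal.ofReal (α j + (ρ : ℝ)⁻¹)⁻¹ *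
      ∫⁻ θ, L θ ∂Measure.pi (fun _ : Fin n => gaussianReal 0 ρ) ≤
      ∫⁻ θ, ENNReal.ofReal ((a j - θ j) ^ 2) * L θ
        ∂Measure.pi (fun _ : Fin n => gaussianReal 0 ρ) := by
    intro j
    -- Freezing the other coordinates makes the problem one-dimensional, so no posterior covariance
    -- matrix has to be inverted.
    rw [lintegral_pi_eq_lintegral_update _ hLm j, lintegral_pi_eq_lintegral_update _
      (f := fun θ => ENNReal.ofReal ((a j - θ j) ^ 2) * L θ) (by fun_prop) j,
      ← lintegral_const_mul' _ _ ENNReal.ofReal_ne_top]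
    refine lintegral_mono fun θ => ?_
    obtain ⟨b, c, h⟩ := hupd θ j
    simp only [h, Function.update_self]
    exact le_lintegral_sub_sq_mul_exp_quadratic hρ (hα0 j) _ _ _
  have hharm : (n : ℝ) ^ 2 / (n / ρ + M / σ) ≤ ∑ j, (α j + (ρ : ℝ)⁻¹)⁻¹ := by
    -- Cauchy–Schwarz in the form `n² / ∑ Λ_j ≤ ∑ 1 / Λ_j`.
    have h := Finset.sq_sum_div_le_sum_sq_div Finset.univ (fun _ : Fin n => (1 : ℝ))
      fun j _ => hΛ j
    simp only [Finset.sum_const, Finset.card_univ, Fintype.card_fin, nsmul_eq_mul, mul_one,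
      one_pow, one_div, Finset.sum_add_distrib] at h
    refine le_trans ?_ h
    have hsum : ∑ j, α j ≤ M / σ := by
      rw [hα, ← Finset.sum_div, Finset.sum_comm]
      gcongr
    have : 0 ≤ ∑ j, α j := Finset.sum_nonneg fun j _ => hα0 j
    rw [add_comm, div_eq_mul_inv (n : ℝ)]
    gcongr
  calc _ ≤ ENNReal.ofReal (∑ j, (α j + (ρ : ℝ)⁻¹)⁻¹) *
        ∫⁻ θ, L θ ∂Measure.pi (fun _ : Fin n => gaussianReal 0 ρ) := by gcongr
    _ = ∑ j, ENNReal.ofReal (α j + (ρ : ℝ)⁻¹)⁻¹ *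
        ∫⁻ θ, L θ ∂Measure.pi (fun _ : Fin n => gaussianReal 0 ρ) := by
      rw [ENNReal.ofReal_sum_of_nonneg fun j _ => (inv_pos.mpr (hΛ j)).le, Finset.sum_mul]
    _ ≤ ∑ j, ∫⁻ θ, ENNReal.ofReal ((a j - θ j) ^ 2) * L θ
        ∂Measure.pi (fun _ : Fin n => gaussianReal 0 ρ) := Finset.sum_le_sum fun j _ => hcoord j
    _ = _ := by
      rw [← lintegral_finsetSum _ fun j _ => by fun_prop]
      refine lintegral_congr fun θ => ?_
      rw [ENNReal.ofReal_sum_of_nonneg fun j _ => sq_nonneg _, Finset.sum_mul]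

/-! ### The hard family of quadratics -/

theorem measurable_euclideanSpace_apply {α : Type*} [MeasurableSpace α] {n : ℕ}
    {x : α → EuclideanSpace ℝ (Fin n)} (hx : Measurable x) (j : Fin n) :
    Measurable fun a => x a j := by
  have h : Measurable fun y : EuclideanSpace ℝ (Fin n) => y j := by fun_prop
  exact h.comp hx

/-- The quadratic function `x ↦ τ / 2 * ‖x - θ‖²`. -/
noncomputable def sphericalQuadratic {n : ℕ} (τ : ℝ) (θ : Fin n → ℝ)
    (x : EuclideanSpace ℝ (Fin n)) : ℝ :=
  τ / 2 * ∑ j, (x j - θ j) ^ 2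

theorem measurable_sphericalQuadratic {α : Type*} [MeasurableSpace α] {n : ℕ} (τ : ℝ)
    {θ : α → Fin n → ℝ} (hθ : Measurable θ) {x : α → EuclideanSpace ℝ (Fin n)}
    (hx : Measurable x) : Measurable fun a => sphericalQuadratic τ (θ a) (x a) := by
  have h := measurable_euclideanSpace_apply hx
  unfold sphericalQuadratic
  fun_prop

/-- The holomorphic extension of `sphericalQuadratic`. -/
noncomputable def sphericalQuadraticExt {n : ℕ} (τ : ℝ) (θ : Fin n → ℝ) (z : Fin n → ℂ) : ℂ :=
  τ / 2 * ∑ j, (z j - θ j) ^ 2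

theorem isQuadratic_sphericalQuadratic {n : ℕ} (τ : ℝ) (θ : Fin n → ℝ) :
    IsQuadratic (sphericalQuadratic τ θ) := by
  refine ⟨τ • 1, fun j => -τ * θ j, τ / 2 * ∑ j, θ j ^ 2, ?_, fun x => ?_⟩
  · simp [Matrix.IsSymm]
  · simp only [sphericalQuadratic, Matrix.smul_mulVec, Matrix.one_mulVec, dotProduct,
      Pi.smul_apply, smul_eq_mul, Finset.mul_sum, ← Finset.sum_add_distrib]
    exact Finset.sum_congr rfl fun j _ => by ring

theorem strongConvexOn_sphericalQuadratic {n : ℕ} (τ : ℝ) (θ : Fin n → ℝ) :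
    StrongConvexOn Set.univ τ (sphericalQuadratic τ θ) := by
  rw [strongConvexOn_iff_convex]
  have h : (fun x : EuclideanSpace ℝ (Fin n) => sphericalQuadratic τ θ x - τ / 2 * ‖x‖ ^ 2) =
      fun x => (∑ j, -τ * θ j * x j) + τ / 2 * ∑ j, θ j ^ 2 := by
    ext x
    rw [EuclideanSpace.real_norm_sq_eq]
    simp only [sphericalQuadratic, Finset.mul_sum, ← Finset.sum_add_distrib,
      ← Finset.sum_sub_distrib]
    exact Finset.sum_congr rfl fun j _ => by ring
  rw [h]
  refine ⟨convex_univ, fun x _ y _ a b _ _ hab => le_of_eq ?_⟩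
  generalize τ / 2 * ∑ j, θ j ^ 2 = r
  simp only [PiLp.add_apply, PiLp.smul_apply, smul_eq_mul, mul_add, Finset.sum_add_distrib]
  rw [Finset.mul_sum, Finset.mul_sum]
  have : ∀ c : ℝ, ∀ z : EuclideanSpace ℝ (Fin n),
      ∑ j, -τ * θ j * (c * z j) = ∑ j, c * (-τ * θ j * z j) := fun c z =>
    Finset.sum_congr rfl fun j _ => by ring
  rw [this, this]
  linear_combination -r * hab

theorem isHolomorphicExtension_sphericalQuadraticExt {n : ℕ} (τ : ℝ) (θ : Fin n → ℝ) :
    IsHolomorphicExtension (sphericalQuadraticExt τ θ) (sphericalQuadratic τ θ) := by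
  refine ⟨by unfold sphericalQuadraticExt; fun_prop, fun x => ?_⟩
  simp [sphericalQuadraticExt, sphericalQuadratic]

theorem sphericalQuadratic_center {n : ℕ} (τ : ℝ) (θ : Fin n → ℝ) :
    sphericalQuadratic τ θ (WithLp.toLp 2 θ) = 0 := by
  simp [sphericalQuadratic]

theorem isMinOn_sphericalQuadratic {n : ℕ} {τ : ℝ} (hτ : 0 ≤ τ) (θ : Fin n → ℝ) :
    IsMinOn (sphericalQuadratic τ θ) Set.univ (WithLp.toLp 2 θ) := by
  intro x _
  simp only [Set.mem_ofPred_eq, sphericalQuadratic_center]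
  unfold sphericalQuadratic
  positivity

/-- Only the cross term of `(x - θ + iδu)²` is imaginary, so `‖θ‖²` drops out and the answer is
affine in `θ`. -/
theorem im_sphericalQuadraticExt_complexPoint {n : ℕ} (τ : ℝ) (θ : Fin n → ℝ)
    (x : EuclideanSpace ℝ (Fin n)) (δ : ℝ) (u : EuclideanSpace ℝ (Fin n)) :
    (sphericalQuadraticExt τ θ (complexPoint x δ u)).im =
      ∑ j, τ * δ * u j * x j - ∑ j, τ * δ * u j * θ j := by
  have h : sphericalQuadraticExt τ θ (complexPoint x δ u) =
      ((τ / 2 * ∑ j, ((x j - θ j) ^ 2 - (δ * u j) ^ 2) : ℝ) : ℂ) +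
        ((∑ j, τ * δ * u j * x j - ∑ j, τ * δ * u j * θ j : ℝ) : ℂ) * Complex.I := by
    rw [← Finset.sum_sub_distrib]
    simp only [sphericalQuadraticExt, complexPoint]
    push_cast
    rw [Finset.sum_mul, Finset.mul_sum, Finset.mul_sum, ← Finset.sum_add_distrib]
    refine Finset.sum_congr rfl fun j _ => ?_
    linear_combination (τ / 2 * (δ * u j) ^ 2 : ℂ) * Complex.I_sq
  rw [h]
  simp only [Complex.add_im, Complex.ofReal_im, Complex.mul_im, Complex.I_im, Complex.I_re,
    Complex.ofReal_re]
  ring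

/-! ### Bayes risk of an algorithm on the hard family -/

namespace Algorithm

variable {n K : ℕ} {S : Type*} [MeasurableSpace S]

theorem measurable_response_sphericalQuadraticExt (A : Algorithm n K S) (τ : ℝ) (k : Fin K)
    {α : Type*} [MeasurableSpace α] {θ : α → Fin n → ℝ} (hθ : Measurable θ) {s : α → S}
    (hs : Measurable s) {v : α → Fin k → ℝ} (hv : Measurable v) :
    Measurable fun a => A.response (sphericalQuadraticExt τ (θ a)) (s a) k (v a) := by
  have hsv : Measurable fun a => (s a, v a) := hs.prodMk hv
  have h1 : Measurable fun a => A.radius k (s a) (v a) := (A.measurable_radius k).comp hsv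
  have hp : Measurable fun a => A.point k (s a) (v a) := (A.measurable_point k).comp hsv
  have hd : Measurable fun a => A.direction k (s a) (v a) := (A.measurable_direction k).comp hsv
  have h2 : ∀ j, Measurable fun a => A.point k (s a) (v a) j := fun j =>
    measurable_euclideanSpace_apply hp j
  have h3 : ∀ j, Measurable fun a => A.direction k (s a) (v a) j := fun j =>
    measurable_euclideanSpace_apply hd j
  simp only [response, im_sphericalQuadraticExt_complexPoint]
  fun_prop

theorem measurable_prod_likelihood_sphericalQuadraticExt (A : Algorithm n K S) (τ : ℝ) (σ : ℝ≥0)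
    {α : Type*} [MeasurableSpace α] {θ : α → Fin n → ℝ} (hθ : Measurable θ) {s : α → S}
    (hs : Measurable s) {w : α → Fin K → ℝ} (hw : Measurable w) :
    Measurable fun a => ∏ i, ENNReal.ofReal
      (A.likelihood (sphericalQuadraticExt τ (θ a)) σ (s a) (w a) i) := by
  refine Finset.measurable_prod _ fun i _ => ?_
  have h : Measurable fun a => A.response (sphericalQuadraticExt τ (θ a)) (s a) i
      (firstAnswers i i.is_lt.le (w a)) :=
    A.measurable_response_sphericalQuadraticExt τ i hθ hs ((measurable_firstAnswers _ _).comp hw)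
  unfold likelihood
  fun_prop

theorem expectedError_sphericalQuadratic (A : Algorithm n K S) (μ : Measure S)
    [IsProbabilityMeasure μ] {τ : ℝ} {σ : ℝ≥0} (hσ : σ ≠ 0) (θ : Fin n → ℝ) :
    A.expectedError μ σ (sphericalQuadratic τ θ) (sphericalQuadraticExt τ θ) (WithLp.toLp 2 θ) =
      ∫⁻ p : S × (Fin K → ℝ), ENNReal.ofReal (sphericalQuadratic τ θ (A.output p.1 p.2)) *
        ∏ i, ENNReal.ofReal (A.likelihood (sphericalQuadraticExt τ θ) σ p.1 p.2 i)
        ∂(μ.prod (Measure.pi fun _ : Fin K => gaussianReal 0 σ)) := by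
  have hm : ∀ k : Fin K, Measurable fun p : S × (Fin k → ℝ) =>
      A.response (sphericalQuadraticExt τ θ) p.1 k p.2 := fun k =>
    A.measurable_response_sphericalQuadraticExt τ k measurable_const measurable_fst measurable_snd
  have hG : Measurable fun p : S × (Fin K → ℝ) =>
      ENNReal.ofReal (sphericalQuadratic τ θ (A.output p.1 p.2)) :=
    (measurable_sphericalQuadratic τ measurable_const A.measurable_output).ennreal_ofReal
  have hL : Measurable fun p : S × (Fin K → ℝ) =>
      ∏ i, ENNReal.ofReal (A.likelihood (sphericalQuadraticExt τ θ) σ p.1 p.2 i) :=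
    A.measurable_prod_likelihood_sphericalQuadraticExt τ σ measurable_const measurable_fst
      measurable_snd
  have hR : Measurable fun p : S × (Fin K → ℝ) => ENNReal.ofReal
      (sphericalQuadratic τ θ (A.result (sphericalQuadraticExt τ θ) p.1 p.2)) := by
    have hr : Measurable fun p : S × (Fin K → ℝ) =>
        A.result (sphericalQuadraticExt τ θ) p.1 p.2 :=
      A.measurable_output.comp (measurable_fst.prodMk (A.measurable_answers hm K le_rfl))
    exact (measurable_sphericalQuadratic τ measurable_const hr).ennreal_ofReal
  simp only [expectedError, sphericalQuadratic_center, sub_zero]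
  rw [lintegral_prod _ hR.aemeasurable]
  refine Eq.trans ?_ (lintegral_prod _ (hG.mul hL).aemeasurable).symm
  refine lintegral_congr fun s => ?_
  have hGs : Measurable fun v => ENNReal.ofReal (sphericalQuadratic τ θ (A.output s v)) := by
    have ho : Measurable fun v => A.output s v := A.measurable_output.comp measurable_prodMk_left
    exact (measurable_sphericalQuadratic τ measurable_const ho).ennreal_ofReal
  have h := A.lintegral_answers (s := s) hσ hm K le_rfl hGs
  simp only [Fin.is_lt, Finset.filter_true] at h
  exact h

theorem lintegral_likelihood_sphericalQuadraticExt (A : Algorithm n K S) (μ : Measure S)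
    [IsProbabilityMeasure μ] (τ : ℝ) {σ : ℝ≥0} (hσ : σ ≠ 0) (θ : Fin n → ℝ) :
    ∫⁻ p : S × (Fin K → ℝ),
        ∏ i, ENNReal.ofReal (A.likelihood (sphericalQuadraticExt τ θ) σ p.1 p.2 i)
        ∂(μ.prod (Measure.pi fun _ : Fin K => gaussianReal 0 σ)) = 1 := by
  have hm : ∀ k : Fin K, Measurable fun p : S × (Fin k → ℝ) =>
      A.response (sphericalQuadraticExt τ θ) p.1 k p.2 := fun k =>
    A.measurable_response_sphericalQuadraticExt τ k measurable_const measurable_fst measurable_snd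
  have hL : Measurable fun p : S × (Fin K → ℝ) =>
      ∏ i, ENNReal.ofReal (A.likelihood (sphericalQuadraticExt τ θ) σ p.1 p.2 i) :=
    A.measurable_prod_likelihood_sphericalQuadraticExt τ σ measurable_const measurable_fst
      measurable_snd
  rw [lintegral_prod _ hL.aemeasurable]
  have : ∀ s, ∫⁻ w, ∏ i, ENNReal.ofReal (A.likelihood (sphericalQuadraticExt τ θ) σ s w i)
      ∂Measure.pi (fun _ : Fin K => gaussianReal 0 σ) = 1 := by
    intro s
    have := A.lintegral_answers (s := s) hσ hm K le_rfl (G := fun _ => 1) measurable_const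
    simpa using this.symm
  simp [this]

theorem sum_sq_radius_mul_direction_le (A : Algorithm n K S) {δmax : ℝ}
    (hδ : ∀ k s v, A.radius k s v ≤ δmax) (τ : ℝ) (s : S) (w : Fin K → ℝ) :
    ∑ k : Fin K, ∑ j, (τ * A.radius k s (firstAnswers k k.is_lt.le w) *
      A.direction k s (firstAnswers k k.is_lt.le w) j) ^ 2 ≤ K * (τ ^ 2 * δmax ^ 2) := by
  have : ∀ k : Fin K, ∑ j, (τ * A.radius k s (firstAnswers k k.is_lt.le w) *
      A.direction k s (firstAnswers k k.is_lt.le w) j) ^ 2 ≤ τ ^ 2 * δmax ^ 2 := by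
    intro k
    simp only [mul_pow]
    rw [← Finset.mul_sum, ← EuclideanSpace.real_norm_sq_eq, A.norm_direction]
    have h0 := (A.radius_pos k s (firstAnswers k k.is_lt.le w)).le
    have := hδ k s (firstAnswers k k.is_lt.le w)
    rw [one_pow, mul_one]
    gcongr
  calc _ ≤ ∑ _k : Fin K, τ ^ 2 * δmax ^ 2 := Finset.sum_le_sum fun k _ => this k
    _ = _ := by simp

/-- The Bayes risk for a Gaussian prior on the minimizer. -/
theorem le_lintegral_expectedError (A : Algorithm n K S) (μ : Measure S)
    [IsProbabilityMeasure μ] {τ δmax : ℝ} (hτ : 0 ≤ τ) {σ ρ : ℝ≥0} (hσ : σ ≠ 0) (hρ : ρ ≠ 0)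
    (hn : 0 < n) (hδ : ∀ k s v, A.radius k s v ≤ δmax) :
    ENNReal.ofReal (τ / 2 * ((n : ℝ) ^ 2 / (n / ρ + K * (τ ^ 2 * δmax ^ 2) / σ))) ≤
      ∫⁻ θ, A.expectedError μ σ (sphericalQuadratic τ θ) (sphericalQuadraticExt τ θ)
        (WithLp.toLp 2 θ) ∂Measure.pi (fun _ : Fin n => gaussianReal 0 ρ) := by
  have hL : Measurable fun q : (Fin n → ℝ) × S × (Fin K → ℝ) =>
      ∏ i, ENNReal.ofReal (A.likelihood (sphericalQuadraticExt τ q.1) σ q.2.1 q.2.2 i) :=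
    A.measurable_prod_likelihood_sphericalQuadraticExt τ σ measurable_fst
      (measurable_fst.comp measurable_snd) (measurable_snd.comp measurable_snd)
  have hG : Measurable fun q : (Fin n → ℝ) × S × (Fin K → ℝ) =>
      ENNReal.ofReal (sphericalQuadratic τ q.1 (A.output q.2.1 q.2.2)) := by
    have ho : Measurable fun q : (Fin n → ℝ) × S × (Fin K → ℝ) => A.output q.2.1 q.2.2 :=
      A.measurable_output.comp measurable_snd
    exact (measurable_sphericalQuadratic τ measurable_fst ho).ennreal_ofReal
  simp_rw [A.expectedError_sphericalQuadratic μ hσ]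
  -- With `θ` innermost, the seed and the answers are constants, and so are the queries and the
  -- output.
  rw [lintegral_lintegral_swap (hG.mul hL).aemeasurable]
  set C : ℝ := (n : ℝ) ^ 2 / (n / ρ + K * (τ ^ 2 * δmax ^ 2) / σ) with hC
  have key : ∀ p : S × (Fin K → ℝ), ENNReal.ofReal (τ / 2 * C) *
      ∫⁻ θ, ∏ i, ENNReal.ofReal (A.likelihood (sphericalQuadraticExt τ θ) σ p.1 p.2 i)
        ∂Measure.pi (fun _ : Fin n => gaussianReal 0 ρ) ≤
      ∫⁻ θ, ENNReal.ofReal (sphericalQuadratic τ θ (A.output p.1 p.2)) *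
        ∏ i, ENNReal.ofReal (A.likelihood (sphericalQuadraticExt τ θ) σ p.1 p.2 i)
        ∂Measure.pi (fun _ : Fin n => gaussianReal 0 ρ) := by
    intro p
    have h := le_lintegral_sum_sub_sq_mul_likelihood hn (σ := σ) hρ _
      (fun k => ∑ j, τ * A.radius k p.1 (firstAnswers k k.is_lt.le p.2) *
        A.direction k p.1 (firstAnswers k k.is_lt.le p.2) j *
          A.point k p.1 (firstAnswers k k.is_lt.le p.2) j)
      p.2 (A.output p.1 p.2) (A.sum_sq_radius_mul_direction_le hδ τ p.1 p.2)
    simp only [likelihood, response, im_sphericalQuadraticExt_complexPoint]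
    have hτ2 : 0 ≤ τ / 2 := by positivity
    simp only [sphericalQuadratic, ENNReal.ofReal_mul hτ2, mul_assoc (ENNReal.ofReal (τ / 2))]
    rw [lintegral_const_mul' _ _ ENNReal.ofReal_ne_top]
    gcongr
  refine le_trans ?_ (lintegral_mono key)
  -- Swapping back, the likelihood integrates to one for each `θ`.
  rw [lintegral_const_mul' _ _ ENNReal.ofReal_ne_top, ← lintegral_lintegral_swap hL.aemeasurable]
  simp [A.lintegral_likelihood_sphericalQuadraticExt μ τ hσ]

end Algorithm
end ImZO

/-! ### Choice of the prior -/

theorem mainTheorem4 :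
    ∃ c : ℝ, 0 < c ∧
      ∀ (n K : ℕ), 1 ≤ n → 1 ≤ K →
      ∀ (τ δmax : ℝ) (σ : ℝ≥0), 0 < τ → 0 < δmax → 0 < σ →
      ∀ (S : Type*) [MeasurableSpace S] (μ : Measure S) [IsProbabilityMeasure μ]
        (A : ImZO.Algorithm n K S), (∀ k s v, A.radius k s v ≤ δmax) →
      ∃ (f : EuclideanSpace ℝ (Fin n) → ℝ) (F : (Fin n → ℂ) → ℂ)
        (xstar : EuclideanSpace ℝ (Fin n)),
        ImZO.IsQuadratic f ∧ StrongConvexOn Set.univ τ f ∧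
        ImZO.IsHolomorphicExtension F f ∧ IsMinOn f Set.univ xstar ∧
        ENNReal.ofReal (c * (n : ℝ) ^ 2 * (σ : ℝ) / (τ * δmax ^ 2 * (K : ℝ))) ≤
          A.expectedError μ σ f F xstar := by
  refine ⟨1 / 8, by norm_num, fun n K hn hK τ δmax σ hτ hδ hσ S _ μ _ A hA => ?_⟩
  suffices h : ∃ θ : Fin n → ℝ,
      ENNReal.ofReal (1 / 8 * (n : ℝ) ^ 2 * (σ : ℝ) / (τ * δmax ^ 2 * (K : ℝ))) ≤
        A.expectedError μ σ (ImZO.sphericalQuadratic τ θ) (ImZO.sphericalQuadraticExt τ θ)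
          (WithLp.toLp 2 θ) by
    obtain ⟨θ, hθ⟩ := h
    exact ⟨_, _, _, ImZO.isQuadratic_sphericalQuadratic τ θ,
      ImZO.strongConvexOn_sphericalQuadratic τ θ,
      ImZO.isHolomorphicExtension_sphericalQuadraticExt τ θ,
      ImZO.isMinOn_sphericalQuadratic hτ.le θ, hθ⟩
  by_contra! h
  have hn' : (0 : ℝ) < n := by exact_mod_cast hn
  have hK' : (0 : ℝ) < K := by exact_mod_cast hK
  have hσ' : (0 : ℝ) < σ := by exact_mod_cast hσ
  -- This variance equates the two terms `n / ρ` and `K τ² δmax² / σ` of the denominator. The Bayes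
  -- risk is then at least `1/4` of the target rate; the constant `1/8` leaves a factor 2, so
  -- non-strict averaging suffices for a contradiction.
  obtain ⟨ρ, hρ⟩ : ∃ ρ : ℝ≥0, (ρ : ℝ) = n * σ / (K * (τ ^ 2 * δmax ^ 2)) :=
    ⟨⟨_, by positivity⟩, rfl⟩
  have hρ0 : ρ ≠ 0 := by
    have : (0 : ℝ) < ρ := hρ ▸ by positivity
    exact_mod_cast this.ne'
  have hlow := A.le_lintegral_expectedError μ hτ.le hσ.ne' hρ0 hn hA
  have hup := lintegral_mono (μ := Measure.pi (fun _ : Fin n => gaussianReal 0 ρ))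
    fun θ => (h θ).le
  have hle := hlow.trans hup
  rw [lintegral_const, measure_univ, mul_one, ENNReal.ofReal_le_ofReal_iff (by positivity)] at hle
  have hval : τ / 2 * ((n : ℝ) ^ 2 / (n / ρ + K * (τ ^ 2 * δmax ^ 2) / σ)) =
      2 * (1 / 8 * (n : ℝ) ^ 2 * (σ : ℝ) / (τ * δmax ^ 2 * (K : ℝ))) := by
    rw [hρ]
    field_simp
    ring
  rw [hval] at hle
  have : 0 < 1 / 8 * (n : ℝ) ^ 2 * (σ : ℝ) / (τ * δmax ^ 2 * (K : ℝ)) := by positivity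
  linarith
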